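/- An affine VASS $\mathcal V=(d,Q,T)$ consists of a number $d\ge 1$ of counters, a finite set $Q$ of control-states and a finite set $T\subseteq Q\times\mathbb Z^{d\times d}\times\mathbb Z^d\times Q$ of transitions. A configuration is a pair $q(\vec v)$ with $q\in Q$, $\vec v\in\mathbb Z^d$. Write $p(\vec u)\to_{\mathbb N}q(\vec v)$ if $\vec u,\vec v\in\mathbb N^d$ and $\vec v=\mathbf A\vec u+\vec b$ for some $(p,\mathbf A,\vec b,q)\in T$, and let $\to^*_{\mathbb N}$ be the reflexive-transitive closure of $\to_{\mathbb N}$. A class is a set $\mathcal C\subseteq\bigcup_{k\ge 1}\mathbb Z^{k\times k}$ of matrices that contains the identity matrix $\mathbf I_n$ for every $n\ge 1$; that contains the product of any two of its members of the same dimension; and that, for every $\mathbf A\in\mathcal C$ of dimension $k$, contains $\mathbf P_\sigma\mathbf A\mathbf P_{\sigma^{-1}}$ for every permutation $\sigma$ of $\{1,\dots,k\}$ with permutation matrix $\mathbf P_\sigma$, and $\begin{pmatrix}\mathbf A&\mathbf 0\\ \mathbf 0&\mathbf I_n\end{pmatrix}$ for every $n\ge 1$. For a fixed class $\mathcal C$,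 the reachability problem $\mathrm{Reach}(\mathcal C)$ is the following: the input is an affine VASS $\mathcal V$ such that all matrices on its transitions are in $\mathcal C$, together with two configurations $p(\vec u)$ and $q(\vec v)$ of $\mathcal V$; the question is whether $p(\vec u)\to^*_{\mathbb N}q(\vec v)$ in $\mathcal V$. **Proposition.** For every class $\mathcal C$ that contains a matrix with some negative entry, $\mathrm{Reach}(\mathcal C)$ is undecidable: no algorithm (partial recursive function) halts with the correct answer on every such input. -/

import Mathlib

/-- A transition `(p, A, b, q)` of an affine VASS with `d` counters and control-states `Q`. -/
structure Transition (d : ℕ) (Q : Type*) where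
  src : Q
  mat : Matrix (Fin d) (Fin d) ℤ
  vec : Fin d → ℤ
  tgt : Q

/-- An affine VASS with `d ≥ 1` counters, a finite set `Q` of control-states, and
finitely many transitions. -/
structure AffineVASS (d : ℕ) (Q : Type*) where
  dim_pos : 1 ≤ d
  finite_states : Finite Q
  transitions : Set (Transition d Q)
  finite_transitions : transitions.Finite

/-- A configuration `q(v)`: a control-state together with a vector of integers. -/
abbrev Configuration (d : ℕ) (Q : Type*) : Type _ := Q × (Fin d → ℤ)

namespace AffineVASS

variable {d : ℕ} {Q : Type*}

/-- `p(u) →ₜ q(v)` under the semantics over the natural numbers: both vectors are nonnegative,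
`t` leads from `p` to `q`, and `v = A * u + b` where `A`, `b` are the matrix and vector of `t`. -/
def NStepVia (t : Transition d Q) (c c' : Configuration d Q) : Prop :=
  (∀ i, 0 ≤ c.2 i) ∧ (∀ i, 0 ≤ c'.2 i) ∧ t.src = c.1 ∧ t.tgt = c'.1 ∧
    c'.2 = t.mat.mulVec c.2 + t.vec

/-- One step of `V` under the semantics over the natural numbers. -/
def NStep (V : AffineVASS d Q) (c c' : Configuration d Q) : Prop :=
  ∃ t ∈ V.transitions, NStepVia t c c'

/-- `c →* c'` in `V` under the semantics over the natural numbers. -/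
def NReach (V : AffineVASS d Q) (c c' : Configuration d Q) : Prop :=
  Relation.ReflTransGen V.NStep c c'

end AffineVASS

/-- The block diagonal matrix with blocks `A` and the `n × n` identity matrix. -/
def extendMatrix {k : ℕ} (A : Matrix (Fin k) (Fin k) ℤ) (n : ℕ) :
    Matrix (Fin (k + n)) (Fin (k + n)) ℤ :=
  Matrix.reindex finSumFinEquiv finSumFinEquiv
    (Matrix.fromBlocks A 0 0 (1 : Matrix (Fin n) (Fin n) ℤ))

/-- The matrix `P_σ * A * P_{σ⁻¹}`, that is, `A` with its counters renamed by `σ`. -/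
def renameMatrix {k : ℕ} (A : Matrix (Fin k) (Fin k) ℤ) (σ : Equiv.Perm (Fin k)) :
    Matrix (Fin k) (Fin k) ℤ :=
  σ.permMatrix ℤ * A * (σ⁻¹).permMatrix ℤ

/-- A set of integer square matrices is given by the sets `C k` of its `k × k` members. It is a
class if its members have dimension at least one, and if it is closed under renaming of counters,
extension to larger dimensions and products, and contains all identity matrices. -/
structure IsMatrixClass (C : (k : ℕ) → Set (Matrix (Fin k) (Fin k) ℤ)) : Prop where
  dim_pos : ∀ {k : ℕ} {A : Matrix (Fin k) (Fin k) ℤ}, A ∈ C k → 1 ≤ k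
  rename_mem : ∀ {k : ℕ} {A : Matrix (Fin k) (Fin k) ℤ}, A ∈ C k →
    ∀ σ : Equiv.Perm (Fin k), renameMatrix A σ ∈ C k
  extend_mem : ∀ {k : ℕ} {A : Matrix (Fin k) (Fin k) ℤ}, A ∈ C k →
    ∀ n : ℕ, 1 ≤ n → extendMatrix A n ∈ C (k + n)
  one_mem : ∀ n : ℕ, 1 ≤ n → (1 : Matrix (Fin n) (Fin n) ℤ) ∈ C n
  mul_mem : ∀ {k : ℕ} {A B : Matrix (Fin k) (Fin k) ℤ}, A ∈ C k → B ∈ C k → A * B ∈ C k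

/-- An affine VASS belongs to `C` if all matrices on its transitions belong to `C`. -/
def AffineVASS.BelongsTo {d : ℕ} {Q : Type*} (V : AffineVASS d Q)
    (C : (k : ℕ) → Set (Matrix (Fin k) (Fin k) ℤ)) : Prop :=
  ∀ t ∈ V.transitions, t.mat ∈ C d

/-- An input of a reachability problem: an affine VASS, whose control-states are numbered and
whose transitions are listed, and two of its configurations. -/
structure ReachInput where
  dim : ℕ
  dim_pos : 1 ≤ dim
  numStates : ℕ
  transitionList : List (Transition dim (Fin numStates))
  source : Configuration dim (Fin numStates)
  target : Configuration dim (Fin numStates)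

/-- The affine VASS of an input. -/
def ReachInput.vass (I : ReachInput) : AffineVASS I.dim (Fin I.numStates) where
  dim_pos := I.dim_pos
  finite_states := inferInstance
  transitions := {t | t ∈ I.transitionList}
  finite_transitions := I.transitionList.finite_toSet

/-- Finite data over the integers to write inputs down for an algorithm: the number of counters,
the number of control-states, the transitions, and two configurations. -/
abbrev ReachCode : Type :=
  ℕ × ℕ × List (ℕ × List (List ℤ) × List ℤ × ℕ) × (ℕ × List ℤ) × (ℕ × List ℤ)

/-- A transition written as finite data; its matrix is written as the list of its rows. -/
def Transition.code {d n : ℕ} (t : Transition d (Fin n)) : ℕ × List (List ℤ) × List ℤ × ℕ :=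
  ((t.src : ℕ), List.ofFn (fun i => List.ofFn (fun j => t.mat i j)), List.ofFn t.vec, (t.tgt : ℕ))

/-- A configuration written as finite data. -/
def configurationCode {d n : ℕ} (c : Configuration d (Fin n)) : ℕ × List ℤ :=
  ((c.1 : ℕ), List.ofFn c.2)

/-- An input written as finite data. -/
def ReachInput.code (I : ReachInput) : ReachCode :=
  (I.dim, I.numStates, I.transitionList.map Transition.code,
    configurationCode I.source, configurationCode I.target)

/-- The problem with inputs `x : ι` satisfying `IsInput x`, presented to the algorithm as `code x`,
and with the question whether `Yes x` holds, is decidable: some partial recursive function halts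
with the correct answer on all inputs. Nothing is required on data that present no input. -/
def DecidableProblem {ι κ : Type*} [Primcodable κ] (code : ι → κ) (IsInput Yes : ι → Prop) : Prop :=
  ∃ f : κ →. Bool, Partrec f ∧ ∀ x, IsInput x → ∃ b ∈ f (code x), (b = true ↔ Yes x)

/-- `Reach(C)` is decidable. Its inputs are an affine VASS that belongs to `C` and two
configurations; the question is whether the second configuration is reachable from the first
under the semantics over the natural numbers. -/
def ReachDecidable (C : (k : ℕ) → Set (Matrix (Fin k) (Fin k) ℤ)) : Prop :=
  DecidableProblem ReachInput.code
    (fun I : ReachInput => I.vass.BelongsTo C)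
    (fun I : ReachInput => I.vass.NReach I.source I.target)

/-! A negative entry `A i₀ j` provides a zero test. Keep `k` auxiliary counters at zero and let `A`
act on them, with the tested counter substituted for the `j`-th. If the tested counter is zero, the
vector is fixed; if it is `n > 0`, one coordinate becomes `A i₀ j * n < 0` and the step is blocked.
Since class members can be extended and renamed, this test is available on every counter, so affine
VASS over the class simulate counter programs with increment, decrement and zero test
(`nonneg_and_eq_iff_exists_exec`).

Such programs semi-decide the domain of every partial recursive function
(`exists_program_of_partrec`). One program is fixed, for the function that runs the `n`-th code on
input 0. Its control-flow graph, with continuations as vertices, becomes one fixed affine VASS; only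
the source vector depends on the code. The map from codes to inputs is therefore computable, and a
decision procedure would solve the halting problem. -/

/-! ### Counter programs and the semantics of loops. -/

/-- Instructions on a state that assigns a natural number to each register. -/
inductive CounterInstr
  | skip
  | inc (i : ℕ)
  | dec (i : ℕ)
  | test (i : ℕ)

/-- The effect of an instruction: `dec` blocks on zero, and `test` blocks unless on zero. -/
def CounterInstr.Exec : CounterInstr → (ℕ → ℕ) → (ℕ → ℕ) → Prop
  | skip, s, t => t = s
  | inc i, s, t => t = Function.update s i (s i + 1)
  | dec i, s, t => 0 < s i ∧ t = Function.update s i (s i - 1)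
  | test i, s, t => s i = 0 ∧ t = s

/-- Nondeterministic structured counter programs. -/
inductive CounterProgram
  | act (a : CounterInstr)
  | seq (P Q : CounterProgram)
  | star (P : CounterProgram)

namespace CounterProgram

open Relation Function

/-- The input-output relation of a program. -/
def Sem : CounterProgram → (ℕ → ℕ) → (ℕ → ℕ) → Prop
  | act a => a.Exec
  | seq P Q => Relation.Comp P.Sem Q.Sem
  | star P => ReflTransGen P.Sem

@[simp] theorem sem_inc {i : ℕ} {s t : ℕ → ℕ} :
    (act (.inc i)).Sem s t ↔ t = update s i (s i + 1) := Iff.rfl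

@[simp] theorem sem_dec {i : ℕ} {s t : ℕ → ℕ} :
    (act (.dec i)).Sem s t ↔ 0 < s i ∧ t = update s i (s i - 1) := Iff.rfl

@[simp] theorem sem_skip {s t : ℕ → ℕ} :
    (act .skip).Sem s t ↔ t = s := Iff.rfl

theorem sem_seq {P Q : CounterProgram} {s t : ℕ → ℕ} :
    (seq P Q).Sem s t ↔ ∃ u, P.Sem s u ∧ Q.Sem u t := Iff.rfl

/-- Along the orbit `S` the relation has at most one successor, so its closure can only walk along
`S`. This turns the nondeterministic `star` into a count of rounds. -/
theorem reflTransGen_iff_of_step_iff {α : Type*} {R : α → α → Prop} {S : ℕ → α} {c : ℕ → Prop}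
    (h : ∀ k t, R (S k) t ↔ c k ∧ t = S (k + 1)) {t : α} :
    ReflTransGen R (S 0) t ↔ ∃ k, (∀ i < k, c i) ∧ t = S k := by
  constructor
  · intro H
    induction H with
    | refl => exact ⟨0, by simp, rfl⟩
    | tail _ hst ih =>
      obtain ⟨k, hk, rfl⟩ := ih
      obtain ⟨hc, rfl⟩ := (h _ _).1 hst
      refine ⟨k + 1, fun i hi => ?_, rfl⟩
      rcases Nat.lt_succ_iff_lt_or_eq.1 hi with hi | rfl
      exacts [hk i hi, hc]
  · rintro ⟨k, hk, rfl⟩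
    induction k with
    | zero => exact .refl
    | succ k ih =>
      exact (ih fun i hi => hk i (by omega)).tail ((h _ _).2 ⟨hk k (by omega), rfl⟩)

/-- The loop that runs `P` any number of times and can be left when register `i` is zero. -/
def loop (P : CounterProgram) (i : ℕ) : CounterProgram := seq (star P) (act (.test i))

theorem sem_loop {P : CounterProgram} {i : ℕ} {s : ℕ → ℕ} {S : ℕ → ℕ → ℕ} {c : ℕ → Prop}
    (h0 : S 0 = s) (h : ∀ k t, P.Sem (S k) t ↔ c k ∧ t = S (k + 1)) {t : ℕ → ℕ} :
    (loop P i).Sem s t ↔ ∃ k, (∀ i < k, c i) ∧ S k i = 0 ∧ t = S k := by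
  subst h0
  simp only [loop, sem_seq, Sem, reflTransGen_iff_of_step_iff h, CounterInstr.Exec]
  grind

/-- The number of rounds is forced: the exit test requires `N - k = 0`, so at least `N` rounds, and
the body blocks after `N`. -/
theorem sem_loop_bounded {P : CounterProgram} {i : ℕ} {s : ℕ → ℕ} (S : ℕ → ℕ → ℕ) (N : ℕ)
    (h0 : S 0 = s) (h : ∀ k t, P.Sem (S k) t ↔ k < N ∧ t = S (k + 1))
    (hi : ∀ k, S k i = N - k) {t : ℕ → ℕ} :
    (loop P i).Sem s t ↔ t = S N := by
  rw [sem_loop h0 h]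
  constructor
  · rintro ⟨k, hk, hz, rfl⟩
    rw [hi] at hz
    rcases k with _ | k
    · congr 1; omega
    · have := hk k (by omega)
      congr 1; omega
  · rintro rfl
    exact ⟨N, by simp, by simp [hi], rfl⟩

/-! ### Basic programs on registers. -/

/-- Set register `r` to zero. -/
def clear (r : ℕ) : CounterProgram := loop (act (.dec r)) r

theorem sem_clear {r : ℕ} {s t : ℕ → ℕ} : (clear r).Sem s t ↔ t = update s r 0 := by
  rw [clear, sem_loop_bounded (fun k => update s r (s r - k)) (s r)]
  · simp
  · simp
  · intro k t
    simp only [sem_dec, update_self, update_idem]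
    rw [Nat.sub_sub]
    constructor <;> rintro ⟨h, rfl⟩ <;> refine ⟨by omega, rfl⟩
  · simp

/-- Add register `x` to register `y` and set `x` to zero. -/
def move (x y : ℕ) : CounterProgram := loop (seq (act (.dec x)) (act (.inc y))) x

theorem sem_move {x y : ℕ} (h : x ≠ y) {s t : ℕ → ℕ} :
    (move x y).Sem s t ↔ t = update (update s x 0) y (s y + s x) := by
  rw [move, sem_loop_bounded (fun k => update (update s x (s x - k)) y (s y + k)) (s x)]
  · simp
  · simp
  · intro k t
    have e : ∀ u : ℕ → ℕ, k < s x →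
        (u = update (update s x (s x - (k + 1))) y (s y + (k + 1)) ↔
        u = update (update (update (update s x (s x - k)) y (s y + k)) x (s x - k - 1)) y
          (s y + k + 1)) := by
      intro u hk
      apply Eq.congr_right
      funext r
      simp only [update_apply]
      split_ifs <;> omega
    simp only [sem_seq, sem_dec, sem_inc, update_self, update_of_ne h]
    constructor
    · rintro ⟨u, ⟨h1, rfl⟩, rfl⟩
      have hk : k < s x := by omega
      refine ⟨hk, (e _ hk).2 ?_⟩
      simp [update_of_ne h.symm]
    · rintro ⟨hk, ht⟩
      refine ⟨_, ⟨by omega, rfl⟩, ?_⟩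
      rw [(e _ hk).1 ht]
      simp [update_of_ne h.symm]
  · simp [update_of_ne h]

/-- Add register `x` to register `y`, keeping `x`, with the help of the zero register `z`. -/
def copy (x y z : ℕ) : CounterProgram :=
  seq (loop (seq (act (.dec x)) (seq (act (.inc y)) (act (.inc z)))) x) (move z x)

theorem sem_copy {x y z : ℕ} (hxy : x ≠ y) (hxz : x ≠ z) (hyz : y ≠ z) {s t : ℕ → ℕ}
    (hz : s z = 0) : (copy x y z).Sem s t ↔ t = update s y (s y + s x) := by
  rw [copy, sem_seq]
  simp only [sem_move hxz.symm]
  have key : ∀ u, (loop (seq (act (.dec x)) (seq (act (.inc y)) (act (.inc z)))) x).Sem s u ↔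
      u = update (update (update s x 0) y (s y + s x)) z (s x) := by
    intro u
    rw [sem_loop_bounded
      (fun k => update (update (update s x (s x - k)) y (s y + k)) z k) (s x)]
    · simp
    · funext r
      simp only [update_apply]
      split_ifs <;> simp_all
    · intro k t
      simp only [sem_seq, sem_dec, sem_inc]
      constructor
      · rintro ⟨u, ⟨h1, rfl⟩, v, rfl, rfl⟩
        simp only [update_apply] at h1
        refine ⟨by grind, ?_⟩
        funext r
        simp only [update_apply]
        grind
      · rintro ⟨hk, rfl⟩
        refine ⟨_, ⟨by simp only [update_apply]; grind, rfl⟩, _, rfl, ?_⟩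
        funext r
        simp only [update_apply]
        grind
    · intro k
      simp [hxy, hxz]
  simp only [key, exists_eq_left]
  apply Eq.congr_right
  funext r
  simp only [update_apply]
  grind

/-! ### Counter programs compute the partial recursive functions. -/

/-- `f` is computed by programs that may use any zero registers from `b` on: they read the arguments
from registers below `b`, leave the value in register `b`, and restore all other registers. -/
def Computes {n : ℕ} (f : List.Vector ℕ n →. ℕ) : Prop :=
  ∀ (ins : Fin n → ℕ) (b : ℕ), (∀ i, ins i < b) → ∃ P : CounterProgram,
    ∀ s : ℕ → ℕ, (∀ r, b ≤ r → s r = 0) → ∀ t,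
      P.Sem s t ↔ ∃ y ∈ f (List.Vector.ofFn fun i => s (ins i)), t = update s b y

theorem computes_zero : Computes (fun _ : List.Vector ℕ 0 => Part.some 0) := by
  intro ins b _
  refine ⟨act .skip, fun s hs t => ?_⟩
  have : update s b 0 = s := by
    rw [update_eq_self_iff, hs b le_rfl]
  simp [this]

theorem computes_get {n : ℕ} (i : Fin n) :
    Computes (fun v : List.Vector ℕ n => Part.some (v.get i)) := by
  intro ins b hb
  refine ⟨copy (ins i) b (b + 1), fun s hs t => ?_⟩
  have := hb i
  rw [sem_copy (by omega) (by omega) (by omega) (hs _ (by omega)), hs b le_rfl]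
  simp

theorem computes_succ : Computes (fun v : List.Vector ℕ 1 => Part.some v.head.succ) := by
  intro ins b hb
  obtain ⟨P, hP⟩ := computes_get (0 : Fin 1) ins b hb
  refine ⟨seq P (act (.inc b)), fun s hs t => ?_⟩
  simp [sem_seq, hP s hs]

/-- Evaluate finitely many functions into consecutive registers. -/
theorem Computes.exists_eval_all {m : ℕ} {ins : Fin m → ℕ} {b : ℕ} (hb : ∀ i, ins i < b) :
    ∀ {n : ℕ} {g : Fin n → List.Vector ℕ m →. ℕ}, (∀ i, Computes (g i)) →
    ∃ P : CounterProgram, ∀ s : ℕ → ℕ, (∀ r, b ≤ r → s r = 0) → ∀ t,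
      P.Sem s t ↔ ∃ ys : ℕ → ℕ,
        (∀ i : Fin n, ys i ∈ g i (List.Vector.ofFn fun i => s (ins i))) ∧
        t = fun r => if b ≤ r ∧ r < b + n then ys (r - b) else s r := by
  intro n
  induction n with
  | zero =>
    intro g hg
    refine ⟨act .skip, fun s hs t => ?_⟩
    have : (fun r => if b ≤ r ∧ r < b + 0 then 0 else s r) = s := by
      funext r
      rw [if_neg (by omega)]
    constructor
    · rintro rfl
      exact ⟨fun _ => 0, fun i => i.elim0, this.symm⟩
    · rintro ⟨ys, -, rfl⟩
      funext r
      rw [if_neg (by omega)]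
  | succ n ih =>
    intro g hg
    obtain ⟨P, hP⟩ := ih fun i => hg i.castSucc
    obtain ⟨Q, hQ⟩ := hg (Fin.last n) ins (b + n) fun i => by have := hb i; omega
    refine ⟨seq P Q, fun s hs t => ?_⟩
    rw [sem_seq]
    have hQ' : ∀ (ys : ℕ → ℕ) t,
        Q.Sem (fun r => if b ≤ r ∧ r < b + n then ys (r - b) else s r) t ↔
        ∃ y ∈ g (Fin.last n) (List.Vector.ofFn fun i => s (ins i)),
          t = update (fun r => if b ≤ r ∧ r < b + n then ys (r - b) else s r) (b + n) y := by
      intro ys t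
      rw [hQ _ (fun r hr => by rw [if_neg (by omega)]; exact hs r (by omega))]
      have : (fun i => if b ≤ ins i ∧ ins i < b + n then ys (ins i - b) else s (ins i)) =
          fun i => s (ins i) := by
        funext i
        have := hb i
        rw [if_neg (by omega)]
      simp only [this]
    constructor
    · rintro ⟨u, hu, ht⟩
      obtain ⟨ys, hys, rfl⟩ := (hP s hs u).1 hu
      obtain ⟨y, hy, rfl⟩ := (hQ' ys t).1 ht
      refine ⟨update ys n y, fun i => ?_, ?_⟩
      · refine Fin.lastCases (by simpa using hy) (fun i => ?_) i
        have := i.2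
        simpa [update_of_ne this.ne] using hys i
      · funext r
        simp only [update_apply]
        grind
    · rintro ⟨ys, hys, rfl⟩
      refine ⟨_, (hP s hs _).2 ⟨ys, fun i => hys i.castSucc, rfl⟩, ?_⟩
      refine (hQ' ys _).2 ⟨ys n, hys (Fin.last n), ?_⟩
      funext r
      simp only [update_apply]
      grind

theorem exists_clear_range (b n : ℕ) : ∃ P : CounterProgram, ∀ s t,
    P.Sem s t ↔ t = fun r => if b ≤ r ∧ r < b + n then 0 else s r := by
  induction n with
  | zero =>
    refine ⟨act .skip, fun s t => Eq.congr_right ?_⟩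
    funext r
    rw [if_neg (by omega)]
  | succ n ih =>
    obtain ⟨P, hP⟩ := ih
    refine ⟨seq P (clear (b + n)), fun s t => ?_⟩
    simp only [sem_seq, hP, sem_clear, exists_eq_left]
    apply Eq.congr_right
    funext r
    simp only [update_apply]
    grind

theorem _root_.List.Vector.mem_mOfFn_part {α : Type*} {n : ℕ} {f : Fin n → Part α}
    {v : List.Vector α n} : v ∈ List.Vector.mOfFn f ↔ ∀ i, v.get i ∈ f i := by
  induction n with
  | zero => simp [List.Vector.mOfFn, pure, Part.mem_some_iff, List.Vector.eq_nil v]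
  | succ n ih =>
    rw [Fin.forall_fin_succ]
    simp only [List.Vector.mOfFn, Part.bind_eq_bind, Part.mem_bind_iff, Part.pure_eq_some,
      Part.mem_some_iff, ih]
    constructor
    · rintro ⟨a, ha, w, hw, rfl⟩
      simpa using ⟨ha, hw⟩
    · rintro ⟨h0, hs⟩
      refine ⟨v.head, by simpa using h0, v.tail, fun i => by simpa using hs i, by simp⟩

/-- The inner values occupy registers `b + 1` to `b + n`, and the outer value goes to `b + 1 + n`.
Register `b` stays free for the result, which is moved there once the inner values are erased. -/
theorem Computes.comp {m n : ℕ} {f : List.Vector ℕ n →. ℕ} {g : Fin n → List.Vector ℕ m →. ℕ}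
    (hf : Computes f) (hg : ∀ i, Computes (g i)) :
    Computes fun v => (List.Vector.mOfFn fun i => g i v) >>= f := by
  intro ins b hb
  obtain ⟨P, hP⟩ := exists_eval_all (b := b + 1) (fun i => (hb i).trans (Nat.lt_succ_self b)) hg
  obtain ⟨Q, hQ⟩ := hf (fun i => b + 1 + i) (b + 1 + n) fun i => by have := i.2; omega
  obtain ⟨R, hR⟩ := exists_clear_range (b + 1) n
  refine ⟨seq P (seq Q (seq R (move (b + 1 + n) b))), fun s hs t => ?_⟩
  simp only [sem_seq, hR, sem_move (show b + 1 + n ≠ b by omega), exists_eq_left]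
  have hQ' : ∀ (ys : ℕ → ℕ) t,
      Q.Sem (fun r => if b + 1 ≤ r ∧ r < b + 1 + n then ys (r - (b + 1)) else s r) t ↔
      ∃ y ∈ f (List.Vector.ofFn fun i : Fin n => ys i),
        t = update (fun r => if b + 1 ≤ r ∧ r < b + 1 + n then ys (r - (b + 1)) else s r)
          (b + 1 + n) y := by
    intro ys t
    rw [hQ _ (fun r hr => by rw [if_neg (by omega)]; exact hs r (by omega))]
    simp
  have hs' : ∀ r, b + 1 ≤ r → s r = 0 := fun r hr => hs r (by omega)
  have hfin : ∀ (ys : ℕ → ℕ) (y : ℕ) (u : ℕ → ℕ),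
      u = update (fun r => if b + 1 ≤ r ∧ r < b + 1 + n then ys (r - (b + 1)) else s r)
          (b + 1 + n) y →
      update (update (fun r => if b + 1 ≤ r ∧ r < b + 1 + n then 0 else u r) (b + 1 + n) 0) b
        ((if b + 1 ≤ b ∧ b < b + 1 + n then 0 else u b) +
          if b + 1 ≤ b + 1 + n ∧ b + 1 + n < b + 1 + n then 0 else u (b + 1 + n)) =
      update s b y := by
    rintro ys y u rfl
    have := hs b le_rfl
    funext r
    by_cases hr : b ≤ r
    · have := hs r hr
      simp only [update_apply]
      grind
    · simp only [update_apply]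
      grind
  constructor
  · rintro ⟨u, hu, w, hw, rfl⟩
    obtain ⟨ys, hys, rfl⟩ := (hP s hs' u).1 hu
    obtain ⟨y, hy, hw'⟩ := (hQ' ys w).1 hw
    refine ⟨y, Part.mem_bind_iff.2 ⟨_, List.Vector.mem_mOfFn_part.2 ?_, hy⟩, hfin ys y w hw'⟩
    simpa using hys
  · rintro ⟨y, hy, rfl⟩
    obtain ⟨v, hv, hy⟩ := Part.mem_bind_iff.1 hy
    rw [List.Vector.mem_mOfFn_part] at hv
    -- The value 0 beyond `n` is a default that is never read.
    let ys : ℕ → ℕ := fun i => if h : i < n then v.get ⟨i, h⟩ else 0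
    have hys : ∀ i : Fin n, ys i = v.get i := fun i => by simp [ys]
    refine ⟨_, (hP s hs' _).2 ⟨ys, fun i => by simpa [hys] using hv i, rfl⟩, _,
      (hQ' ys _).2 ⟨y, by simpa [hys] using hy, rfl⟩, (hfin ys y _ rfl).symm⟩

theorem Computes.exists_program_of_total {n : ℕ} {f : List.Vector ℕ n → ℕ}
    (hf : Computes (f : List.Vector ℕ n →. ℕ)) {ins : Fin n → ℕ} {b : ℕ} (hb : ∀ i, ins i < b) :
    ∃ P : CounterProgram, ∀ s : ℕ → ℕ, (∀ r, b ≤ r → s r = 0) → ∀ t,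
      P.Sem s t ↔ t = update s b (f (List.Vector.ofFn fun i => s (ins i))) := by
  obtain ⟨P, hP⟩ := hf ins b hb
  refine ⟨P, fun s hs t => ?_⟩
  simp [hP s hs]

/-- Register `b` holds the current value, `b + 1` the index and `b + 2` the rounds still to do.
Register `b + 3` is scratch for copying the recursion argument and later receives the value of `g`.
-/
theorem Computes.prec {n : ℕ} {f : List.Vector ℕ n → ℕ} {g : List.Vector ℕ (n + 2) → ℕ}
    (hf : Computes (f : List.Vector ℕ n →. ℕ)) (hg : Computes (g : List.Vector ℕ (n + 2) →. ℕ)) :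
    Computes ((fun v : List.Vector ℕ (n + 1) =>
      v.head.rec (f v.tail) fun y IH => g (y ::ᵥ IH ::ᵥ v.tail) :
        List.Vector ℕ (n + 1) → ℕ) : List.Vector ℕ (n + 1) →. ℕ) := by
  intro ins b hb
  have h0 := hb 0
  obtain ⟨P, hP⟩ := hf.exists_program_of_total (fun i : Fin n => hb i.succ)
  obtain ⟨Q, hQ⟩ := hg.exists_program_of_total
    (ins := Fin.cons (b + 1) (Fin.cons b fun i : Fin n => ins i.succ)) (b := b + 3) (by
      intro i
      refine Fin.cases (by simp) (fun i => Fin.cases (by simp) (fun i => ?_) i) i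
      have := hb i.succ
      simp only [Fin.cons_succ]
      omega)
  let body := seq (act (.dec (b + 2))) (seq Q (seq (clear b)
    (seq (move (b + 3) b) (act (.inc (b + 1))))))
  refine ⟨seq P (seq (copy (ins 0) (b + 2) (b + 3)) (seq (loop body (b + 2)) (clear (b + 1)))),
    fun s hs t => ?_⟩
  set v : List.Vector ℕ n := List.Vector.ofFn fun i => s (ins i.succ) with hv
  set rec' : ℕ → ℕ := fun k => Nat.rec (f v) (fun y IH => g (y ::ᵥ IH ::ᵥ v)) k with hrec
  set S : ℕ → ℕ → ℕ := fun k =>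
    update (update (update s b (rec' k)) (b + 1) k) (b + 2) (s (ins 0) - k) with hS
  have hbody : ∀ k t, body.Sem (S k) t ↔ k < s (ins 0) ∧ t = S (k + 1) := by
    intro k t
    have e1 : S k (b + 2) = s (ins 0) - k := by simp [hS]
    simp only [body, sem_seq, sem_dec, e1, and_assoc, exists_and_left, exists_eq_left, sem_clear,
      sem_move (show b + 3 ≠ b by omega), sem_inc]
    rw [tsub_pos_iff_lt]
    refine and_congr_right fun hk => ?_
    have hz : ∀ r, b + 3 ≤ r → update (S k) (b + 2) (s (ins 0) - k - 1) r = 0 := by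
      intro r hr
      simp [hS, hs r (by omega), show r ≠ b + 2 by omega, show r ≠ b by omega,
        show r ≠ b + 1 by omega]
    have hargs : (List.Vector.ofFn fun i => update (S k) (b + 2) (s (ins 0) - k - 1)
        ((Fin.cons (b + 1) (Fin.cons b fun i : Fin n => ins i.succ) : Fin (n + 2) → ℕ) i)) =
        k ::ᵥ rec' k ::ᵥ v := by
      have : ∀ i : Fin n, ins i.succ ≠ b + 2 ∧ ins i.succ ≠ b + 1 ∧ ins i.succ ≠ b := by
        intro i
        have := hb i.succ
        omega
      simp [List.Vector.ofFn, hS, hv, this]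
    simp only [hQ _ hz, hargs, exists_eq_left]
    apply Eq.congr_right
    have hr1 : rec' (k + 1) = g (k ::ᵥ rec' k ::ᵥ v) := rfl
    rw [← hr1]
    have := hs (b + 3) (by omega)
    funext r
    simp only [hS, update_apply]
    grind
  have hstart : S 0 = update (update s b (f v)) (b + 2)
      (update s b (f v) (b + 2) + update s b (f v) (ins 0)) := by
    have h1 := hs (b + 1) (by omega)
    have h2 := hs (b + 2) (by omega)
    have : rec' 0 = f v := rfl
    funext r
    simp only [hS, update_apply]
    grind
  have hloop : ∀ t, (loop body (b + 2)).Sem _ t ↔ t = S (s (ins 0)) := fun t =>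
    sem_loop_bounded S (s (ins 0)) hstart hbody (fun k => by simp [hS])
  have hz : update s b (f v) (b + 3) = 0 := by simp [hs (b + 3)]
  simp only [sem_seq, hP s hs, exists_eq_left, ← hv]
  simp only [sem_copy (show ins 0 ≠ b + 2 by omega) (show ins 0 ≠ b + 3 by omega)
    (show b + 2 ≠ b + 3 by omega) hz, exists_eq_left, sem_clear, hloop]
  have hval : (List.Vector.ofFn fun i => s (ins i)) = s (ins 0) ::ᵥ v := rfl
  simp only [hval, PFun.coe_val, List.Vector.head_cons, List.Vector.tail_cons, Part.mem_some_iff,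
    exists_eq_left]
  apply Eq.congr_right
  have h1 := hs (b + 1) (by omega)
  have h2 := hs (b + 2) (by omega)
  change _ = update s b (rec' (s (ins 0)))
  funext r
  simp only [hS, update_apply]
  grind

/-- Register `b` holds the candidate `k` and `b + 1` the value of `f` there. The body needs this
value nonzero and the exit needs it zero, so the loop stops exactly at the least zero, and no run
ends if there is none. -/
theorem Computes.rfind {n : ℕ} {f : List.Vector ℕ (n + 1) → ℕ}
    (hf : Computes (f : List.Vector ℕ (n + 1) →. ℕ)) :
    Computes fun v => Nat.rfind fun n => Part.some (decide (f (n ::ᵥ v) = 0)) := by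
  intro ins b hb
  obtain ⟨P, hP⟩ := hf.exists_program_of_total
    (ins := Fin.cons b ins) (b := b + 1) (by
      intro i
      refine Fin.cases (by simp) (fun i => ?_) i
      have := hb i
      simp only [Fin.cons_succ]
      omega)
  -- The `dec` serves as a test for nonzero; `clear` then restores the scratch register before `P`
  -- is run again.
  let body := seq (act (.dec (b + 1))) (seq (clear (b + 1)) (seq (act (.inc b)) P))
  refine ⟨seq P (loop body (b + 1)), fun s hs t => ?_⟩
  set v : List.Vector ℕ n := List.Vector.ofFn fun i => s (ins i) with hv
  set S : ℕ → ℕ → ℕ := fun k => update (update s b k) (b + 1) (f (k ::ᵥ v)) with hS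
  have hP' : ∀ k t, P.Sem (update s b k) t ↔ t = S k := by
    intro k t
    rw [hP]
    · have : (List.Vector.ofFn fun i => update s b k ((Fin.cons b ins : Fin (n + 1) → ℕ) i)) =
          k ::ᵥ v := by
        have : ∀ i, ins i ≠ b := fun i => (hb i).ne
        simp [List.Vector.ofFn, hv, this]
      rw [this]
    · intro r hr
      rw [update_of_ne (by omega), hs r (by omega)]
  have hbody : ∀ k t, body.Sem (S k) t ↔ f (k ::ᵥ v) ≠ 0 ∧ t = S (k + 1) := by
    intro k t
    have e1 : S k (b + 1) = f (k ::ᵥ v) := by simp [hS]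
    simp only [body, sem_seq, sem_dec, e1, and_assoc, exists_and_left, exists_eq_left, sem_clear,
      sem_inc, ← Nat.pos_iff_ne_zero]
    refine and_congr_right fun _ => ?_
    rw [← hP' (k + 1)]
    apply iff_of_eq
    congr 1
    have h1 := hs (b + 1) (by omega)
    funext r
    simp only [hS, update_apply]
    grind
  have hstart : ∀ t, P.Sem s t ↔ t = S 0 := by
    intro t
    rw [← hP' 0 t, update_eq_self_iff.2 (hs b le_rfl).symm]
  simp only [sem_seq, hstart, exists_eq_left]
  rw [sem_loop rfl hbody]
  refine exists_congr fun k => ?_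
  have e1 : S k (b + 1) = f (k ::ᵥ v) := by simp [hS]
  have e3 : k ∈ Nat.rfind (fun n => Part.some (decide (f (n ::ᵥ v) = 0))) ↔
      f (k ::ᵥ v) = 0 ∧ ∀ m < k, f (m ::ᵥ v) ≠ 0 := by
    refine Nat.mem_rfind.trans ?_
    simp
  rw [e1, e3]
  have e2 : f (k ::ᵥ v) = 0 → S k = update s b k := by
    intro h
    have h1 := hs (b + 1) (by omega)
    funext r
    simp only [hS, update_apply]
    grind
  grind

theorem computes_of_primrec' {n : ℕ} {f : List.Vector ℕ n → ℕ} (hf : Nat.Primrec' f) :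
    Computes (f : List.Vector ℕ n →. ℕ) := by
  induction hf with
  | zero => exact computes_zero
  | succ => exact computes_succ
  | get i => exact computes_get i
  | comp g _ _ hf hg =>
    refine (congrArg Computes (funext fun v => ?_)).mp (hf.comp hg)
    simp only [PFun.coe_val, Vector.mOfFn_part_some]
    exact Part.bind_some _ _
  | prec _ _ hf hg => exact hf.prec hg

theorem computes_of_partrec' {n : ℕ} {f : List.Vector ℕ n →. ℕ} (hf : Nat.Partrec' f) :
    Computes f := by
  induction hf with
  | prim hf => exact computes_of_primrec' hf
  | comp g _ _ hf hg => exact hf.comp hg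
  | rfind _ hf => exact hf.rfind

/-- The domain of a partial recursive function is recognized by a program. -/
theorem exists_program_of_partrec {f : ℕ →. ℕ} (hf : Partrec f) : ∃ P : CounterProgram, ∀ a,
    ((∃ t, P.Sem (update 0 0 a) t) → (f a).Dom) ∧ ((f a).Dom → P.Sem (update 0 0 a) 0) := by
  obtain ⟨P, hP⟩ := computes_of_partrec' (Nat.Partrec'.part_iff₁.2 hf) (fun _ => 0) 1
    (fun _ => Nat.zero_lt_one)
  -- Erasing argument and value makes every halting run end in the zero state, so that a single
  -- target configuration suffices.
  refine ⟨seq P (seq (clear 0) (clear 1)), fun a => ?_⟩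
  have hP' : ∀ t, P.Sem (update 0 0 a) t ↔ ∃ y ∈ f a, t = update (update (0 : ℕ → ℕ) 0 a) 1 y := by
    intro t
    rw [hP _ fun r hr => by rw [update_of_ne (by omega), Pi.zero_apply]]
    simp [List.Vector.ofFn]
  constructor
  · rintro ⟨t, u, hu, -⟩
    obtain ⟨y, hy, -⟩ := (hP' u).1 hu
    exact Part.dom_iff_mem.2 ⟨y, hy⟩
  · intro h
    obtain ⟨y, hy⟩ := Part.dom_iff_mem.1 h
    refine ⟨_, (hP' _).2 ⟨y, hy, rfl⟩, _, sem_clear.2 rfl, sem_clear.2 ?_⟩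
    funext r
    simp only [update_apply, Pi.zero_apply]
    grind

/-! ### Control-flow graphs of counter programs. -/

/-- An edge of a control-flow graph whose vertices are continuations, that is, lists of programs
that remain to be run. -/
abbrev Edge : Type := List CounterProgram × CounterInstr × List CounterProgram

/-- The control-flow graph of a program followed by a continuation. -/
def edges : CounterProgram → List CounterProgram → List Edge
  | act a, K => [(act a :: K, a, K)]
  | seq P Q, K => (seq P Q :: K, .skip, P :: Q :: K) :: (edges P (Q :: K) ++ edges Q K)
  | star P, K => (star P :: K, .skip, K) :: (star P :: K, .skip, P :: star P :: K) ::
      edges P (star P :: K)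

/-- One step in a control-flow graph. -/
def Step (E : List Edge) (x y : List CounterProgram × (ℕ → ℕ)) : Prop :=
  ∃ a, (x.1, a, y.1) ∈ E ∧ a.Exec x.2 y.2

/-- The input-output relation of a continuation. -/
def SemList : List CounterProgram → (ℕ → ℕ) → (ℕ → ℕ) → Prop
  | [], s, t => t = s
  | P :: K, s, t => ∃ u, P.Sem s u ∧ SemList K u t

theorem Step.mono {E E' : List Edge} (h : E ⊆ E') {x y : List CounterProgram × (ℕ → ℕ)} :
    Step E x y → Step E' x y := fun ⟨a, ha, hx⟩ => ⟨a, h ha, hx⟩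

/-- Every edge is sound for the meaning of its two continuations, wherever in the program it arises.
Hence it does no harm if different places of a program give the same vertex. -/
theorem semList_of_mem_edges {P : CounterProgram} {K K₁ K₂ : List CounterProgram}
    {a : CounterInstr} (h : (K₁, a, K₂) ∈ edges P K) {s u t : ℕ → ℕ} (hs : a.Exec s u)
    (hu : SemList K₂ u t) : SemList K₁ s t := by
  induction P generalizing K with
  | act b =>
    simp only [edges, List.mem_singleton, Prod.mk.injEq] at h
    obtain ⟨rfl, rfl, rfl⟩ := h
    exact ⟨u, hs, hu⟩
  | seq P Q ihP ihQ =>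
    simp only [edges, List.mem_cons, List.mem_append, Prod.mk.injEq] at h
    rcases h with ⟨rfl, rfl, rfl⟩ | h | h
    · obtain rfl : u = s := hs
      obtain ⟨v, hv, w, hw, ht⟩ := hu
      exact ⟨w, ⟨v, hv, hw⟩, ht⟩
    · exact ihP h
    · exact ihQ h
  | star P ih =>
    simp only [edges, List.mem_cons, Prod.mk.injEq] at h
    rcases h with ⟨rfl, rfl, rfl⟩ | ⟨rfl, rfl, rfl⟩ | h
    · obtain rfl : u = s := hs
      exact ⟨u, .refl, hu⟩
    · obtain rfl : u = s := hs
      obtain ⟨v, hv, w, hw, ht⟩ := hu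
      exact ⟨w, .head hv hw, ht⟩
    · exact ih h

/-- The property `SemList` holds at the empty continuation and is carried backwards along the path.
-/
theorem exists_sem_of_path {P : CounterProgram} {s t : ℕ → ℕ}
    (h : ReflTransGen (Step (edges P [])) ([P], s) ([], t)) : P.Sem s t := by
  have key : ∀ x, ReflTransGen (Step (edges P [])) x ([], t) → SemList x.1 x.2 t := by
    intro x hx
    induction hx using ReflTransGen.head_induction_on with
    | refl => exact rfl
    | head h _ ih =>
      obtain ⟨a, ha, hs⟩ := h
      exact semList_of_mem_edges ha hs ih
  obtain ⟨u, hu, rfl⟩ := key _ h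
  exact hu

theorem path_of_sem {P : CounterProgram} {K : List CounterProgram} {s t : ℕ → ℕ}
    (h : P.Sem s t) : ReflTransGen (Step (edges P K)) (P :: K, s) (K, t) := by
  induction P generalizing K s t with
  | act a => exact .single ⟨a, by simp [edges], h⟩
  | seq P Q ihP ihQ =>
    obtain ⟨u, hP, hQ⟩ := h
    refine .head (b := (P :: Q :: K, s)) ⟨.skip, by simp [edges], rfl⟩
      (.trans (b := (Q :: K, u)) ?_ ?_)
    · exact (ihP hP).lift id fun _ _ => Step.mono fun x hx => by simp [edges, hx]
    · exact (ihQ hQ).lift id fun _ _ => Step.mono fun x hx => by simp [edges, hx]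
  | star P ih =>
    have h' : ReflTransGen P.Sem s t := h
    induction h' using ReflTransGen.head_induction_on with
    | refl => exact .single ⟨.skip, by simp [edges], rfl⟩
    | @head s u hP hst ih' =>
      refine .head (b := (P :: star P :: K, s)) ⟨.skip, by simp [edges], rfl⟩
        (.trans (b := (star P :: K, u)) ?_ (ih' hst))
      exact (ih hP).lift id fun _ _ => Step.mono fun x hx => by simp [edges, hx]

end CounterProgram

/-! ### Zero tests from a matrix with a negative entry. -/

section

open Relation Function Matrix

theorem renameMatrix_mulVec {k : ℕ} (A : Matrix (Fin k) (Fin k) ℤ) (σ : Equiv.Perm (Fin k))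
    (v : Fin k → ℤ) : renameMatrix A σ *ᵥ v = (A *ᵥ (v ∘ ⇑σ⁻¹)) ∘ σ := by
  rw [renameMatrix, ← mulVec_mulVec, ← mulVec_mulVec, permMatrix_mulVec, permMatrix_mulVec]

theorem extendMatrix_mulVec_castAdd {k : ℕ} (A : Matrix (Fin k) (Fin k) ℤ) (n : ℕ)
    (v : Fin (k + n) → ℤ) (i : Fin k) :
    (extendMatrix A n *ᵥ v) (Fin.castAdd n i) = ∑ j, A i j * v (Fin.castAdd n j) := by
  simp [extendMatrix, mulVec, dotProduct, Fin.sum_univ_add]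

theorem extendMatrix_mulVec_natAdd {k : ℕ} (A : Matrix (Fin k) (Fin k) ℤ) (n : ℕ)
    (v : Fin (k + n) → ℤ) (i : Fin n) :
    (extendMatrix A n *ᵥ v) (Fin.natAdd k i) = v (Fin.natAdd k i) := by
  simp [extendMatrix, mulVec, dotProduct, Fin.sum_univ_add, one_apply]

/-- The matrix `A` applied to the first `k` counters, with counter `k + i` in the role of `j`. -/
def testMatrix {k : ℕ} (A : Matrix (Fin k) (Fin k) ℤ) (j : Fin k) {m : ℕ} (i : Fin m) :
    Matrix (Fin (k + m)) (Fin (k + m)) ℤ :=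
  renameMatrix (extendMatrix A m) (Equiv.swap (Fin.castAdd m j) (Fin.natAdd k i))

/-- The counter values that represent a register state: `k` zeros and the first `m` registers. -/
def stateVec (k m : ℕ) (s : ℕ → ℕ) : Fin (k + m) → ℤ :=
  fun x => if x.val < k then 0 else (s (x.val - k) : ℤ)

theorem stateVec_nonneg {k m : ℕ} (s : ℕ → ℕ) (x : Fin (k + m)) : 0 ≤ stateVec k m s x := by
  unfold stateVec
  split_ifs <;> simp

@[simp] theorem stateVec_castAdd {k m : ℕ} (s : ℕ → ℕ) (x : Fin k) :
    stateVec k m s (Fin.castAdd m x) = 0 := by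
  simp [stateVec]

@[simp] theorem stateVec_natAdd {k m : ℕ} (s : ℕ → ℕ) (x : Fin m) :
    stateVec k m s (Fin.natAdd k x) = s x := by
  simp [stateVec]

/-- Both swapped counters are zero, so the renaming does not change the vector, and `A` acts on
zeros only. -/
theorem testMatrix_mulVec_of_eq_zero {k m : ℕ} (A : Matrix (Fin k) (Fin k) ℤ) (j : Fin k)
    (i : Fin m) {s : ℕ → ℕ} (h : s i = 0) :
    testMatrix A j i *ᵥ stateVec k m s = stateVec k m s := by
  have hswap : ∀ x, stateVec k m s (Equiv.swap (Fin.castAdd m j) (Fin.natAdd k i) x) =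
      stateVec k m s x := by
    intro x
    by_cases hx : x = Fin.castAdd m j
    · subst hx; simp [h]
    by_cases hx' : x = Fin.natAdd k i
    · subst hx'; simp [h]
    rw [Equiv.swap_apply_of_ne_of_ne hx hx']
  have hcomp : stateVec k m s ∘ ⇑(Equiv.swap (Fin.castAdd m j) (Fin.natAdd k i))⁻¹ =
      stateVec k m s := by
    funext x
    simp [hswap]
  have hext : extendMatrix A m *ᵥ stateVec k m s = stateVec k m s := by
    funext x
    refine Fin.addCases (fun x => ?_) (fun x => ?_) x
    · simp [extendMatrix_mulVec_castAdd]
    · rw [extendMatrix_mulVec_natAdd]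
  rw [testMatrix, renameMatrix_mulVec, hcomp, hext]
  exact funext hswap

theorem exists_testMatrix_mulVec_neg {k m : ℕ} {A : Matrix (Fin k) (Fin k) ℤ} {i₀ j : Fin k}
    (hA : A i₀ j < 0) (i : Fin m) {s : ℕ → ℕ} (h : 0 < s i) :
    ∃ x, (testMatrix A j i *ᵥ stateVec k m s) x < 0 := by
  -- The negative value arises in row `i₀`, which the renaming carries to this counter; it is
  -- counter `k + i` itself if `i₀ = j`.
  refine ⟨Equiv.swap (Fin.castAdd m j) (Fin.natAdd k i) (Fin.castAdd m i₀), ?_⟩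
  rw [testMatrix, renameMatrix_mulVec]
  simp only [Function.comp_apply, Equiv.swap_apply_self, extendMatrix_mulVec_castAdd, Equiv.swap_inv]
  rw [Finset.sum_eq_single j]
  · simpa using mul_neg_of_neg_of_pos hA (by exact_mod_cast h)
  · intro x _ hx
    rw [Equiv.swap_apply_of_ne_of_ne]
    · simp
    · simpa using hx
    · intro he
      have := congrArg Fin.val he
      have := x.2
      simp at *
      omega
  · simp

theorem testMatrix_mem {C : (k : ℕ) → Set (Matrix (Fin k) (Fin k) ℤ)} (hC : IsMatrixClass C)
    {k m : ℕ} {A : Matrix (Fin k) (Fin k) ℤ} (hA : A ∈ C k) (j : Fin k) (i : Fin m) :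
    testMatrix A j i ∈ C (k + m) :=
  hC.rename_mem (hC.extend_mem hA m (by have := i.2; omega)) _

namespace CounterInstr

/-- The register that an instruction uses. -/
def reg : CounterInstr → ℕ
  | skip => 0
  | inc i => i
  | dec i => i
  | test i => i

/-- The matrix of the transition that simulates an instruction. -/
def mat {k : ℕ} (A : Matrix (Fin k) (Fin k) ℤ) (j : Fin k) (m : ℕ) :
    CounterInstr → Matrix (Fin (k + m)) (Fin (k + m)) ℤ
  -- The identity is a default for registers out of range; the simulation assumes `a.reg < m`.
  | test i => if h : i < m then testMatrix A j ⟨i, h⟩ else 1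
  | _ => 1

/-- The vector of the transition that simulates an instruction. -/
def vec (k m : ℕ) : CounterInstr → Fin (k + m) → ℤ
  | inc i => fun x => if x.val = k + i then 1 else 0
  | dec i => fun x => if x.val = k + i then -1 else 0
  | _ => 0

theorem mat_mem {C : (k : ℕ) → Set (Matrix (Fin k) (Fin k) ℤ)} (hC : IsMatrixClass C)
    {k m : ℕ} {A : Matrix (Fin k) (Fin k) ℤ} (hA : A ∈ C k) (j : Fin k) (a : CounterInstr) :
    a.mat A j m ∈ C (k + m) := by
  have h1 : (1 : Matrix (Fin (k + m)) (Fin (k + m)) ℤ) ∈ C (k + m) :=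
    hC.one_mem _ (by have := hC.dim_pos hA; omega)
  cases a with
  | test i =>
    simp only [mat]
    split_ifs
    exacts [testMatrix_mem hC hA j _, h1]
  | _ => exact h1

theorem stateVec_add_vec_inc {k m i : ℕ} (s : ℕ → ℕ) :
    stateVec k m s + (inc i).vec k m = stateVec k m (update s i (s i + 1)) := by
  funext x
  simp only [stateVec, vec, Pi.add_apply, update_apply]
  grind

theorem stateVec_add_vec_dec {k m i : ℕ} {s : ℕ → ℕ} (h : 0 < s i) :
    stateVec k m s + (dec i).vec k m = stateVec k m (update s i (s i - 1)) := by
  funext x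
  simp only [stateVec, vec, Pi.add_apply, update_apply]
  grind

/-- The transition of an instruction simulates it on vectors that represent states. -/
theorem nonneg_and_eq_iff_exists_exec {k m : ℕ} {A : Matrix (Fin k) (Fin k) ℤ} {i₀ j : Fin k}
    (hA : A i₀ j < 0) {a : CounterInstr} (ha : a.reg < m) {s : ℕ → ℕ} {w : Fin (k + m) → ℤ} :
    ((∀ x, 0 ≤ w x) ∧ w = a.mat A j m *ᵥ stateVec k m s + a.vec k m) ↔
      ∃ t, a.Exec s t ∧ w = stateVec k m t := by
  cases a with
  | skip =>
    simp only [mat, vec, one_mulVec, add_zero, Exec, exists_eq_left, and_iff_right_iff_imp]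
    rintro rfl
    exact stateVec_nonneg s
  | inc i =>
    simp only [mat, one_mulVec, Exec, exists_eq_left, stateVec_add_vec_inc, and_iff_right_iff_imp]
    rintro rfl
    exact stateVec_nonneg _
  | dec i =>
    simp only [mat, one_mulVec, Exec]
    constructor
    · rintro ⟨h0, rfl⟩
      -- Nonnegativity of the new vector is what makes the decrement block at zero.
      have hpos : 0 < s i := by
        have := h0 (Fin.natAdd k ⟨i, ha⟩)
        simp only [Pi.add_apply, stateVec_natAdd, vec, Fin.val_natAdd, if_true] at this
        omega
      exact ⟨_, ⟨hpos, rfl⟩, stateVec_add_vec_dec hpos⟩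
    · rintro ⟨t, ⟨hpos, rfl⟩, rfl⟩
      exact ⟨stateVec_nonneg _, (stateVec_add_vec_dec hpos).symm⟩
  | test i =>
    have hi : i < m := ha
    simp only [mat, vec, Exec, dif_pos hi, add_zero]
    constructor
    · rintro ⟨h0, rfl⟩
      have hz : s i = 0 := by
        by_contra hne
        obtain ⟨x, hx⟩ := exists_testMatrix_mulVec_neg hA ⟨i, hi⟩ (Nat.pos_of_ne_zero hne)
        exact absurd (h0 x) (not_le.2 hx)
      exact ⟨s, ⟨hz, rfl⟩, testMatrix_mulVec_of_eq_zero A j ⟨i, hi⟩ hz⟩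
    · rintro ⟨t, ⟨hz, rfl⟩, rfl⟩
      exact ⟨stateVec_nonneg _, (testMatrix_mulVec_of_eq_zero A j ⟨i, hi⟩ hz).symm⟩

end CounterInstr

/-! ### Simulation of control-flow graphs by affine VASS. -/

namespace CounterProgram

open Classical in
/-- A numbering of vertices that is injective on the members of `L`. -/
noncomputable def label (L : List (List CounterProgram)) (K : List CounterProgram) :
    Fin (L.length + 1) :=
  ⟨L.idxOf K, Nat.lt_succ_of_le List.idxOf_le_length⟩

theorem label_inj {L : List (List CounterProgram)} {K K' : List CounterProgram} (h : K ∈ L) :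
    label L K = label L K' ↔ K = K' := by
  classical
  rw [label, label, Fin.mk.injEq, List.idxOf_inj h]

/-- The transition that simulates an edge of a control-flow graph. -/
noncomputable def edgeTransition {k : ℕ} (A : Matrix (Fin k) (Fin k) ℤ) (j : Fin k) (m : ℕ)
    (L : List (List CounterProgram)) (e : Edge) : Transition (k + m) (Fin (L.length + 1)) :=
  ⟨label L e.1, e.2.1.mat A j m, e.2.1.vec k m, label L e.2.2⟩

section Simulation

variable {k m : ℕ} {A : Matrix (Fin k) (Fin k) ℤ} {i₀ j : Fin k} {E : List Edge}
  {L : List (List CounterProgram)} {V : AffineVASS (k + m) (Fin (L.length + 1))}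

theorem nStep_of_step (hA : A i₀ j < 0) (hE : ∀ e ∈ E, e.2.1.reg < m)
    (hV : V.transitions = {t | t ∈ E.map (edgeTransition A j m L)})
    {x y : List CounterProgram × (ℕ → ℕ)} (h : Step E x y) :
    V.NStep (label L x.1, stateVec k m x.2) (label L y.1, stateVec k m y.2) := by
  obtain ⟨a, ha, hs⟩ := h
  obtain ⟨h0, he⟩ := (CounterInstr.nonneg_and_eq_iff_exists_exec hA (hE _ ha)).2 ⟨_, hs, rfl⟩
  refine ⟨edgeTransition A j m L (x.1, a, y.1), ?_, stateVec_nonneg _, h0, rfl, rfl, he⟩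
  rw [hV]
  exact List.mem_map_of_mem ha

/-- This preserves the invariant behind the simulation: the auxiliary counters remain zero, and the
rest represents a register state. -/
theorem exists_step_of_nStep (hA : A i₀ j < 0) (hE : ∀ e ∈ E, e.2.1.reg < m)
    (hL : ∀ e ∈ E, e.1 ∈ L ∧ e.2.2 ∈ L)
    (hV : V.transitions = {t | t ∈ E.map (edgeTransition A j m L)})
    {K : List CounterProgram} {s : ℕ → ℕ}
    {c : Configuration (k + m) (Fin (L.length + 1))}
    (h : V.NStep (label L K, stateVec k m s) c) :
    ∃ K' t, K' ∈ L ∧ Step E (K, s) (K', t) ∧ c = (label L K', stateVec k m t) := by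
  obtain ⟨t, ht, -, h0, hsrc, htgt, he⟩ := h
  rw [hV] at ht
  obtain ⟨⟨K₁, a, K₂⟩, hmem, rfl⟩ := List.mem_map.1 ht
  -- Injectivity of `label` needs only one of the vertices in `L`, and the edge supplies it.
  obtain rfl : K₁ = K := (label_inj (hL _ hmem).1).1 hsrc
  obtain ⟨t, hexec, hw⟩ := (CounterInstr.nonneg_and_eq_iff_exists_exec hA (hE _ hmem)).1 ⟨h0, he⟩
  exact ⟨K₂, t, (hL _ hmem).2, ⟨a, hmem, hexec⟩, Prod.ext htgt.symm hw⟩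

theorem exists_path_of_nReach (hA : A i₀ j < 0) (hE : ∀ e ∈ E, e.2.1.reg < m)
    (hL : ∀ e ∈ E, e.1 ∈ L ∧ e.2.2 ∈ L)
    (hV : V.transitions = {t | t ∈ E.map (edgeTransition A j m L)})
    {K : List CounterProgram} (hK : K ∈ L) {s : ℕ → ℕ}
    {c : Configuration (k + m) (Fin (L.length + 1))}
    (h : V.NReach (label L K, stateVec k m s) c) :
    ∃ K' t, K' ∈ L ∧ ReflTransGen (Step E) (K, s) (K', t) ∧
      c = (label L K', stateVec k m t) := by
  induction h with
  | refl => exact ⟨K, s, hK, .refl, rfl⟩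
  | tail _ h ih =>
    obtain ⟨K', t, -, hp, rfl⟩ := ih
    obtain ⟨K'', u, hK'', hs, rfl⟩ := exists_step_of_nStep hA hE hL hV h
    exact ⟨K'', u, hK'', hp.tail hs, rfl⟩

end Simulation

/-- The vertices of the control-flow graph of a program. -/
def vertices (P : CounterProgram) : List (List CounterProgram) :=
  [P] :: [] :: (edges P []).flatMap fun e => [e.1, e.2.2]

theorem mem_vertices_of_mem_edges {P : CounterProgram} {e : Edge} (he : e ∈ edges P []) :
    e.1 ∈ vertices P ∧ e.2.2 ∈ vertices P := by
  simp only [vertices, List.mem_cons, List.mem_flatMap]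
  exact ⟨.inr (.inr ⟨e, he, by simp⟩), .inr (.inr ⟨e, he, by simp⟩)⟩

theorem exists_reg_bound (E : List Edge) : ∃ m, ∀ e ∈ E, e.2.1.reg < m + 1 :=
  ⟨(E.map fun e => e.2.1.reg).sum, fun _ he => Nat.lt_succ_of_le
    (List.single_le_sum (fun _ _ => Nat.zero_le _) _ (List.mem_map_of_mem he))⟩

/-- The question whether a program, started with `a` in register zero, can end with all registers
zero, as an input of the reachability problem. -/
noncomputable def reachInput {k : ℕ} (A : Matrix (Fin k) (Fin k) ℤ) (j : Fin k) (m : ℕ)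
    (P : CounterProgram) (a : ℕ) : ReachInput where
  dim := k + (m + 1)
  dim_pos := by omega
  numStates := (vertices P).length + 1
  transitionList := (edges P []).map (edgeTransition A j (m + 1) (vertices P))
  source := (label (vertices P) [P], stateVec k (m + 1) (update 0 0 a))
  target := (label (vertices P) [], stateVec k (m + 1) 0)

theorem reachInput_belongsTo {C : (k : ℕ) → Set (Matrix (Fin k) (Fin k) ℤ)}
    (hC : IsMatrixClass C) {k : ℕ} {A : Matrix (Fin k) (Fin k) ℤ} (hA : A ∈ C k) (j : Fin k)
    (m : ℕ) (P : CounterProgram) (a : ℕ) : (reachInput A j m P a).vass.BelongsTo C := by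
  intro t ht
  obtain ⟨e, -, rfl⟩ := List.mem_map.1 (show t ∈ List.map _ _ from ht)
  exact CounterInstr.mat_mem hC hA j _

/-- Soundness uses any terminating run, whereas completeness needs a run that ends in the zero
state; hence the two separate hypotheses on `p`. -/
theorem reachInput_nReach_iff {k : ℕ} {A : Matrix (Fin k) (Fin k) ℤ} {i₀ j : Fin k}
    (hA : A i₀ j < 0) {m : ℕ} {P : CounterProgram} (hm : ∀ e ∈ edges P [], e.2.1.reg < m + 1)
    {a : ℕ} {p : Prop} (h₁ : (∃ t, P.Sem (update 0 0 a) t) → p)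
    (h₂ : p → P.Sem (update 0 0 a) 0) :
    (reachInput A j m P a).vass.NReach (reachInput A j m P a).source
      (reachInput A j m P a).target ↔ p := by
  constructor
  · intro h
    obtain ⟨K, t, hK, hpath, hc⟩ := exists_path_of_nReach (V := (reachInput A j m P a).vass) hA hm
      (fun e => mem_vertices_of_mem_edges) rfl (by simp [vertices]) h
    obtain rfl : K = [] := (label_inj hK).1 (congrArg Prod.fst hc).symm
    exact h₁ ⟨t, exists_sem_of_path hpath⟩
  · intro hp
    exact (path_of_sem (K := []) (h₂ hp)).lift
      (fun x => (label (vertices P) x.1, stateVec k (m + 1) x.2))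
      fun _ _ h => nStep_of_step (V := (reachInput A j m P a).vass) hA hm rfl h

/-! ### Computability of the reduction. -/

theorem _root_.Primrec.intCast : Primrec ((↑) : ℕ → ℤ) := by
  rw [← Primrec.encode_iff]
  exact Primrec.nat_mul.comp (Primrec.const 2) Primrec.id

theorem ofFn_stateVec_update (k m a : ℕ) :
    List.ofFn (stateVec k (m + 1) (update 0 0 a)) =
      List.replicate k 0 ++ (a : ℤ) :: List.replicate m 0 := by
  rw [List.ofFn_add, List.ofFn_succ]
  congr 1
  · refine List.ext_getElem (by simp) fun i h h' => ?_
    simp [stateVec]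
  · congr 1
    · simp [stateVec]
    · refine List.ext_getElem (by simp) fun i h h' => ?_
      simp [stateVec]

/-- Only one entry of the source vector varies with `a`. The rest, including the noncomputable
labels, is a constant. -/
theorem computable_reachInput_code {k : ℕ} (A : Matrix (Fin k) (Fin k) ℤ) (j : Fin k) (m : ℕ)
    (P : CounterProgram) : Computable fun a => (reachInput A j m P a).code := by
  have h : Primrec fun a : ℕ => List.ofFn (stateVec k (m + 1) (update 0 0 a)) := by
    simp only [ofFn_stateVec_update]
    exact Primrec.list_append.comp (Primrec.const _)
      (Primrec.list_cons.comp Primrec.intCast (Primrec.const _))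
  have h' : ∀ (x₁ x₂ : ℕ) (x₃ : List (ℕ × List (List ℤ) × List ℤ × ℕ)) (x₄ : ℕ) (x₅ : ℕ × List ℤ),
      Primrec fun a : ℕ => ((x₁, x₂, x₃,
        (x₄, List.ofFn (stateVec k (m + 1) (update 0 0 a))), x₅) : ReachCode) :=
    fun _ _ _ _ _ => (Primrec.const _).pair ((Primrec.const _).pair ((Primrec.const _).pair
      (((Primrec.const _).pair h).pair (Primrec.const _))))
  exact (h' (k + (m + 1)) ((vertices P).length + 1)
    (((edges P []).map (edgeTransition A j (m + 1) (vertices P))).map Transition.code)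
    (label (vertices P) [P]) (configurationCode (label (vertices P) [], stateVec k (m + 1) 0)
      : ℕ × List ℤ)).to_comp

end CounterProgram

end

theorem proposition4p3 (C : (k : ℕ) → Set (Matrix (Fin k) (Fin k) ℤ)) (hC : IsMatrixClass C)
    (hneg : ∃ (k : ℕ) (A : Matrix (Fin k) (Fin k) ℤ), A ∈ C k ∧ ∃ i j : Fin k, A i j < 0) :
    ¬ ReachDecidable C := by
  rintro ⟨d, hd, hdec⟩
  obtain ⟨k, A, hAC, i₀, j, hA⟩ := hneg
  -- A universal function, so that one program `P` serves for all codes.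
  have hf : Partrec fun n : ℕ => (Denumerable.ofNat Nat.Partrec.Code n).eval 0 :=
    Nat.Partrec.Code.eval_part.comp (Computable.ofNat _) (Computable.const 0)
  obtain ⟨P, hP⟩ := CounterProgram.exists_program_of_partrec hf
  obtain ⟨m, hm⟩ := CounterProgram.exists_reg_bound (CounterProgram.edges P [])
  let I : Nat.Partrec.Code → ReachInput := fun c =>
    CounterProgram.reachInput A j m P (Encodable.encode c)
  have hI : ∀ c, (I c).vass.NReach (I c).source (I c).target ↔ (c.eval 0).Dom := fun c => by
    have := hP (Encodable.encode c)
    rw [Denumerable.ofNat_encode] at this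
    exact CounterProgram.reachInput_nReach_iff hA hm this.1 this.2
  choose b hb hbI using fun c => hdec (I c) (CounterProgram.reachInput_belongsTo hC hAC j m P _)
  have hcomp : Computable b := by
    -- All the produced inputs belong to the class, so `d` halts on each of them; composed with the
    -- reduction it is the total function `b`.
    refine Partrec.of_eq (hd.comp
      ((CounterProgram.computable_reachInput_code A j m P).comp Computable.encode)) fun c => ?_
    exact Part.eq_some_iff.2 (hb c)
  refine ComputablePred.halting_problem 0 (ComputablePred.computable_iff.2 ⟨b, hcomp, ?_⟩)
  funext c
  exact propext ((hI c).symm.trans (hbI c).symm)
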